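/- \textbf{Setting.} $N$ processes are located at distinct, commonly known points of the Euclidean plane. They compute in synchronous rounds; in a round each process may send a message to every process, and the receiver of a message knows its true sender. Let $M\ge 1$ and let $F$ be a bounded convex set in the plane of diameter $D$. An adversary places $M$ congruent copies of $F$ anywhere in the plane, in any orientation. The processes in the interior or on the boundary of one of these fault areas are Byzantine (they may send anything to anyone); all others are correct. The correct processes know $M$ and $D$ but not the placement. Every process has an input in $\{0,1\}$. An algorithm \emph{solves geoconsensus} if, for every placement, all inputs and every computation, no correct process ever changes an output that it has made, no two correct processes decide differently (agreement), if all correct processes have input $v$ then all of them decide $v$ (validity), and every correct process eventually decides (termination). \textbf{Algorithm PSL} (Pease, Shostak, Lamport) for a set $P$ of $n$ processes, at most $m$ of them faulty. For a string $p_1p_2\cdots p_k$ over $P$ let $\sigma(p_1\cdots p_k)$ be the value that $p_2$ told $p_1$ that $p_3$ told $p_2$ that $\dots$ that $p_k$ told $p_{k-1}$ is the input of $p_k$; $\sigma(p)$ is the input of $p$. In $m+1$ rounds the processes exchange all these values for strings of length up to $m+2$ (a missing value counts as $0$). Then each $p$ records a value for each $q\in P$. For $q=p$ it records $\sigma(p)$.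 For $q\ne p$: if for some $Q\subseteq P$ with $|Q|>(n+m)/2$ and some value $v$ one has $\sigma(pwq)=v$ for all strings $w$ over $Q$ of length at most $m$, then $p$ records $v$; otherwise $p$ applies the same procedure for $m-1$ to $P\setminus\{q\}$ with $\hat\sigma(pw)=\sigma(pwq)$, and records the value that occurs at least $\lfloor (n+m)/2\rfloor$ times among the $n-1$ results, or NIL if there is none (for $m=0$, where a value is always found in the first way, nothing more is done). The decision of $p$ is the majority of its $n$ recorded values ($0$ if $1$ is not recorded more often than $0$). \textbf{Algorithm BASIC.} Each process computes locally the same set $\mathcal P_D$ of leaders: starting from $P_C$ equal to the set of all processes and $\mathcal P_D=\emptyset$, as long as $P_C\neq\emptyset$, among the $p\in P_C$ such that the processes of $P_C$ at distance at most $D$ from $p$ include no four with pairwise distances greater than $D$, choose the lexicographically smallest one (by $x$-coordinate, then $y$-coordinate), add it to $\mathcal P_D$, and remove from $P_C$ it and all processes at distance at most $D$ from it. The leaders run PSL with $P=\mathcal P_D$, $m=M$, broadcast their decision to all processes in one further round, and output it. A process that is not a leader outputs $v$ once it has received the decision $v$ from at least $2M+1$ leaders. \textbf{Theorem.} Suppose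 that at least $9M+3$ of the processes have pairwise distances greater than $D$. Then BASIC solves geoconsensus for $M$ fault areas congruent to $F$, whatever the number $f$ of Byzantine processes, which always satisfies $f\le N-(2M+1)$. It finishes in $M+2$ communication rounds: after $M+2$ rounds all correct processes have decided, and they send no further messages. -/

import Mathlib

noncomputable section

open scoped Classical

namespace Geoconsensus

/-! ### Synchronous message passing with Byzantine processes -/

/-- A deterministic synchronous message-passing algorithm for the processes `ι` with inputs and
outputs in `V`. Rounds are numbered `0, 1, 2, …`. In each round, process `i` sends a message
(or none) to each process, depending on its current state, then updates its state according to
the messages received; `recv r i s inbox` gets in `inbox k` what `k` sent to `i` in round `r`, so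
the sender of a message is always known to the receiver. -/
structure SyncAlgorithm (ι V : Type) where
  State : Type
  Msg : Type
  init : ι → V → State
  send : ℕ → ι → State → ι → Option Msg
  recv : ℕ → ι → State → (ι → Option Msg) → State
  output : State → Option V

/-- A computation of `A` with inputs `x` and set `B` of Byzantine processes. `state r i` is the
state of `i` after `r` rounds, `msg r i j` is what `i` sends to `j` in round `r`. Correct processes
follow `A`; nothing is required of the processes in `B`, which may send anything to anyone. -/
structure IsComputation {ι V : Type} (A : SyncAlgorithm ι V) (B : Set ι) (x : ι → V)
    (state : ℕ → ι → A.State) (msg : ℕ → ι → ι → Option A.Msg) : Prop where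
  start : ∀ i, i ∉ B → state 0 i = A.init i (x i)
  sends : ∀ i, i ∉ B → ∀ r j, msg r i j = A.send r i (state r i) j
  step : ∀ i, i ∉ B → ∀ r, state (r + 1) i = A.recv r i (state r i) (fun k => msg r k i)

/-- The requirements of consensus, where `dec r i` is the output of `i` after `r` rounds
(`none` as long as `i` has not decided) and `B` is the set of Byzantine processes. -/
structure IsConsensus {ι V : Type} (B : Set ι) (x : ι → V) (dec : ℕ → ι → Option V) : Prop where
  irrevocable : ∀ i, i ∉ B → ∀ r s v, r ≤ s → dec r i = some v → dec s i = some v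
  agreement : ∀ i j, i ∉ B → j ∉ B → ∀ r s u v, dec r i = some u → dec s j = some v → u = v
  validity : ∀ v, (∀ i, i ∉ B → x i = v) → ∀ i, i ∉ B → ∃ r, dec r i = some v
  termination : ∀ i, i ∉ B → ∃ r v, dec r i = some v

/-! ### Processes and fault areas in the plane -/

abbrev Plane : Type := EuclideanSpace ℝ (Fin 2)

/-- A fault area is a convex set of finite size. -/
def IsFaultArea (F : Set Plane) : Prop :=
  Convex ℝ F ∧ Bornology.IsBounded F

/-- The processes covered by one of `M` copies of `F`, the `k`-th one being placed in the plane by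
the isometry `g k` (any location and orientation). A process is covered by an area if it is in the
interior or on the boundary of that area. The covered processes are exactly the faulty ones. -/
def faulty {N M : ℕ} (pos : Fin N → Plane) (F : Set Plane) (g : Fin M → Plane ≃ᵢ Plane) :
    Set (Fin N) :=
  {i | ∃ k, pos i ∈ closure (g k '' F)}

/-- `A` solves the Byzantine geoconsensus problem for the processes located at `pos` and `M` fault
areas congruent to `F`: for every placement of the areas and all inputs, every computation satisfies
the requirements of consensus. -/
def SolvesGeoconsensus {N : ℕ} (A : SyncAlgorithm (Fin N) Bool) (pos : Fin N → Plane)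
    (F : Set Plane) (M : ℕ) : Prop :=
  ∀ (g : Fin M → Plane ≃ᵢ Plane) (x : Fin N → Bool)
    (state : ℕ → Fin N → A.State) (msg : ℕ → Fin N → Fin N → Option A.Msg),
    IsComputation A (faulty pos F g) x state msg →
      IsConsensus (faulty pos F g) x (fun r i => A.output (state r i))

/-- In every computation of `A`, after `R` rounds all correct processes have decided, and they send
no messages in later rounds. -/
def FinishesWithin {N : ℕ} (A : SyncAlgorithm (Fin N) Bool) (pos : Fin N → Plane)
    (F : Set Plane) (M R : ℕ) : Prop :=
  ∀ (g : Fin M → Plane ≃ᵢ Plane) (x : Fin N → Bool)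
    (state : ℕ → Fin N → A.State) (msg : ℕ → Fin N → Fin N → Option A.Msg),
    IsComputation A (faulty pos F g) x state msg →
      ∀ i, i ∉ faulty pos F g →
        (∃ v, A.output (state R i) = some v) ∧ ∀ r, R ≤ r → ∀ j, msg r i j = none

/-! ### Leader selection -/

/-- Distance-`D` independent set: pairwise distances are greater than `D`. -/
def Independent {N : ℕ} (pos : Fin N → Plane) (D : ℝ) (I : Finset (Fin N)) : Prop :=
  ∀ i ∈ I, ∀ j ∈ I, i ≠ j → D < dist (pos i) (pos j)

/-- The distance-`D` neighborhood of `i` among the processes of `C`. -/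
def nb {N : ℕ} (pos : Fin N → Plane) (D : ℝ) (C : Finset (Fin N)) (i : Fin N) : Finset (Fin N) :=
  C.filter (fun j => dist (pos i) (pos j) ≤ D)

/-- The candidates whose neighborhood has no independent set of more than three processes. -/
def cand3 {N : ℕ} (pos : Fin N → Plane) (D : ℝ) (C : Finset (Fin N)) : Finset (Fin N) :=
  C.filter (fun i => ∀ I : Finset (Fin N), I ⊆ nb pos D C i → Independent pos D I → I.card ≤ 3)

def LexLT (a b : Plane) : Prop :=
  a 0 < b 0 ∨ (a 0 = b 0 ∧ a 1 < b 1)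

/-- `i` is the lexicographically smallest process of `cand3 pos D C`. -/
def IsNext {N : ℕ} (pos : Fin N → Plane) (D : ℝ) (C : Finset (Fin N)) (i : Fin N) : Prop :=
  i ∈ cand3 pos D C ∧ ∀ j ∈ cand3 pos D C, j ≠ i → LexLT (pos i) (pos j)

/-- The selection loop, with current set `C` of candidates and current set `L` of leaders. The value
is `none` if the loop gets stuck, that is, if there is no process to select although candidates are
left. -/
def selectLoop {N : ℕ} (pos : Fin N → Plane) (D : ℝ) (C L : Finset (Fin N)) :
    Option (Finset (Fin N)) :=
  if C = ∅ then some L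
  else if h : ∃ i, IsNext pos D C i then
    selectLoop pos D ((C.erase h.choose) \ nb pos D C h.choose) (insert h.choose L)
  else none
termination_by C.card
decreasing_by
  have hi : h.choose ∈ C := (Finset.mem_filter.mp h.choose_spec.1).1
  exact lt_of_le_of_lt (Finset.card_le_card Finset.sdiff_subset) (Finset.card_erase_lt_of_mem hi)

/-- The leaders; every process computes this set locally from the known coordinates. -/
def leaders {N : ℕ} (pos : Fin N → Plane) (D : ℝ) : Option (Finset (Fin N)) :=
  selectLoop pos D Finset.univ ∅

/-! ### The algorithm of Pease, Shostak and Lamport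

For a string `w = p₁ p₂ … pₖ` of processes beginning with `p₁ = p`, process `p` records in `σ w` the
value that `p₂` told `p` that `p₃` told `p₂` that … that `pₖ` told `pₖ₋₁` is the input of `pₖ`;
`σ [p]` is the input of `p` itself. -/

/-- For some set `Q ⊆ P` of more than `(|P| + m) / 2` processes, `σ (p w q) = v` for all
strings `w` over `Q` of length at most `m`. -/
def Confirmed {N : ℕ} (m : ℕ) (P : Finset (Fin N)) (σ : List (Fin N) → Bool) (p q : Fin N)
    (v : Bool) : Prop :=
  ∃ Q : Finset (Fin N), Q ⊆ P ∧ P.card + m < 2 * Q.card ∧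
    ∀ w : List (Fin N), w.length ≤ m → (∀ a ∈ w, a ∈ Q) → σ (p :: (w ++ [q])) = v

/-- The value that `p`, knowing `σ`, records for `q` when the processes are `P`, at most `m` of them
faulty; `none` stands for the default NIL. If no value is confirmed, then `p` applies the
procedure for `m - 1` to `P \ {q}`, where the value of each process is the one that it got from `q`,
and records the value that occurs at least `⌊(|P| + m) / 2⌋` times in the result. -/
def pslRecord {N : ℕ} : ℕ → Finset (Fin N) → (List (Fin N) → Bool) → Fin N → Fin N → Option Bool
  | 0, P, σ, p, q =>
    if q = p then some (σ [p])
    else if Confirmed 0 P σ p q true then some true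
    else if Confirmed 0 P σ p q false then some false
    else none
  | m + 1, P, σ, p, q =>
    if q = p then some (σ [p])
    else if Confirmed (m + 1) P σ p q true then some true
    else if Confirmed (m + 1) P σ p q false then some false
    else
      let vec : Fin N → Option Bool := pslRecord m (P.erase q) (fun w => σ (w ++ [q])) p
      if (P.card + (m + 1)) / 2 ≤ ((P.erase q).filter (fun a => vec a = some true)).card then
        some true
      else if (P.card + (m + 1)) / 2 ≤ ((P.erase q).filter (fun a => vec a = some false)).card then
        some false
      else none

/-- The decision of `p`: the majority of the recorded values, `0` (`false`) in case of a tie. -/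
def pslDecision {N : ℕ} (m : ℕ) (P : Finset (Fin N)) (σ : List (Fin N) → Bool) (p : Fin N) : Bool :=
  decide ((P.filter (fun q => pslRecord m P σ p q = some false)).card <
    (P.filter (fun q => pslRecord m P σ p q = some true)).card)

/-! ### The algorithm BASIC -/

/-- A message reports the recorded values of some strings, or a decision. -/
inductive Msg (N : ℕ) : Type
  | report (ρ : List (Fin N) → Option Bool)
  | decision (v : Bool)

/-- Local memory: `record` is the `σ` of a leader, `heard` the set of pairs `(l, v)` such that the
decision `v` was received from leader `l`, and `out` the output. -/
structure LocalState (N : ℕ) : Type where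
  record : List (Fin N) → Bool
  heard : Finset (Fin N × Bool)
  out : Option Bool

/-- Round `r` of the information exchange: leader `p` reports its records for the strings of length
`r + 1` over the leaders that begin with `p`. -/
def pslReport {N : ℕ} (L : Finset (Fin N)) (r : ℕ) (p : Fin N) (σ : List (Fin N) → Bool) : Msg N :=
  Msg.report (fun w =>
    if w.head? = some p ∧ w.length = r + 1 ∧ ∀ a ∈ w, a ∈ L then some (σ w) else none)

/-- The value reported for `w`; the default `0` (`false`) if there is none. -/
def reportedValue {N : ℕ} (m : Option (Msg N)) (w : List (Fin N)) : Bool :=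
  match m with
  | some (Msg.report ρ) => (ρ w).getD false
  | _ => false

/-- After round `r` of the information exchange, `p` records what each `q` reported: its record for
`p q w` is the value reported by `q` for `q w`, where `q w` has length `r + 1`. -/
def pslUpdate {N : ℕ} (r : ℕ) (p : Fin N) (σ : List (Fin N) → Bool)
    (inbox : Fin N → Option (Msg N)) : List (Fin N) → Bool
  | a :: q :: w =>
    if a = p ∧ w.length = r then reportedValue (inbox q) (q :: w) else σ (a :: q :: w)
  | s => σ s

/-- The decision messages from leaders contained in `inbox`. -/
def decisionsIn {N : ℕ} (L : Finset (Fin N)) (inbox : Fin N → Option (Msg N)) :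
    Finset (Fin N × Bool) :=
  Finset.univ.filter (fun a => a.1 ∈ L ∧ inbox a.1 = some (Msg.decision a.2))

/-- The decision `v` was received from at least `2 * M + 1` leaders. -/
def Supported {N : ℕ} (M : ℕ) (heard : Finset (Fin N × Bool)) (v : Bool) : Prop :=
  2 * M + 1 ≤ (heard.filter (fun a => a.2 = v)).card

/-- Messages sent in round `r`. In rounds `0, …, M` the leaders exchange reports with each other; in
round `M + 1` they broadcast their decision. -/
def basicSend {N : ℕ} (M : ℕ) (L : Finset (Fin N)) (r : ℕ) (p : Fin N) (s : LocalState N)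
    (q : Fin N) : Option (Msg N) :=
  if p ∈ L then
    if r ≤ M then
      if q ∈ L then some (pslReport L r p s.record) else none
    else if r = M + 1 then some (Msg.decision (pslDecision M L s.record p))
    else none
  else none

/-- Processing of the messages received in round `r`. A leader updates its records in rounds
`0, …, M`, and outputs its decision in round `M + 1`, when it has been broadcast. A non-leader
collects the decisions of the leaders until `2 * M + 1` leaders agree, and outputs their decision. -/
def basicRecv {N : ℕ} (M : ℕ) (L : Finset (Fin N)) (r : ℕ) (p : Fin N) (s : LocalState N)
    (inbox : Fin N → Option (Msg N)) : LocalState N :=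
  if p ∈ L then
    if r ≤ M then { s with record := pslUpdate r p s.record inbox }
    else if r = M + 1 then { s with out := some (pslDecision M L s.record p) }
    else s
  else
    let heard := s.heard ∪ decisionsIn L inbox
    { s with
      heard := heard
      out :=
        if s.out ≠ none then s.out
        else if Supported M heard true then some true
        else if Supported M heard false then some false
        else none }

/-- The algorithm BASIC. If the selection of leaders got stuck, nothing would ever be output. -/
def basic {N : ℕ} (pos : Fin N → Plane) (M : ℕ) (D : ℝ) : SyncAlgorithm (Fin N) Bool where
  State := LocalState N
  Msg := Msg N
  init p v := { record := fun w => if w = [p] then v else false, heard := ∅, out := none }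
  send r p s q :=
    match leaders pos D with
    | some L => basicSend M L r p s q
    | none => none
  recv r p s inbox :=
    match leaders pos D with
    | some L => basicRecv M L r p s inbox
    | none => s
  output s := s.out

end Geoconsensus

end

/-!
A copy of the fault area has diameter `D`, so it covers at most one member of a set of processes
with pairwise distances greater than `D`; `M` copies cover at most `M` (`card_faulty_le`). Applied
to the given `9 * M + 3` processes, this bounds the number of Byzantine processes; applied to the
leaders, it shows that at most `M` of them are Byzantine.

The selection of leaders never gets stuck: the neighbors of the lexicographically smallest candidate
lie in a half-disc, which has at most three points with pairwise distances greater than `D`, since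
two points in a sector of angle `π / 3` are at most `D` apart (`card_le_three_of_half_disc`). Each
selected leader removes at most three of the given `9 * M + 3` processes, so there are at least
`3 * M + 1` leaders (`selectLoop_spec`).

For `n > 3 * m` processes, `m` of them faulty, the correct ones record the same values
(`pslRecord_agree`, by induction on `m`). The value of a correct process is confirmed by the set of
all correct processes. Let `q` be faulty. Two sets of more than `(n + m) / 2` processes share a
correct one, so two confirmed values for `q` agree. If `Q` confirms `v` for a correct `p`, then
`Q \ {q}` makes `p` record `v` in the procedure for `m - 1` for each of its at least
`⌊(n + m) / 2⌋` members; by induction every other correct process finds these values too, and the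
opposite value cannot occur as often. If no correct process has a confirmed value, the induction
hypothesis is all that is needed.

In a computation of BASIC the records of the leaders after `M + 1` rounds satisfy the hypothesis of
that result (`IsRun.faithful`), so the correct leaders broadcast one decision `v`. At least
`2 * M + 1` leaders support `v`, and the other value is supported by at most the `M` Byzantine ones,
so non-leaders output `v` as well (`IsRun.out_final`).
-/

namespace Geoconsensus

open scoped Classical

/-! ### Fault areas and independent sets -/

theorem dist_le_of_mem_area {F : Set Plane} (hF : Bornology.IsBounded F) (g : Plane ≃ᵢ Plane)
    {a b : Plane} (ha : a ∈ closure (g '' F)) (hb : b ∈ closure (g '' F)) :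
    dist a b ≤ Metric.diam F := by
  have hbd : Bornology.IsBounded (closure (g '' F)) :=
    (g.isometry.lipschitz.isBounded_image hF).closure
  have h := Metric.dist_le_diam_of_mem hbd ha hb
  rwa [Metric.diam_closure, g.isometry.diam_image] at h

theorem card_faulty_le {N M : ℕ} {pos : Fin N → Plane} {F : Set Plane}
    (hF : Bornology.IsBounded F) (g : Fin M → Plane ≃ᵢ Plane) {I : Finset (Fin N)}
    (hI : Independent pos (Metric.diam F) I) :
    (I.filter (· ∈ faulty pos F g)).card ≤ M := by
  have hex : ∀ i : Fin N, ∃ k : Option (Fin M), i ∈ faulty pos F g →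
      ∃ k', k = some k' ∧ pos i ∈ closure (g k' '' F) := by
    intro i
    by_cases h : i ∈ faulty pos F g
    · obtain ⟨k, hk⟩ := h
      exact ⟨some k, fun _ => ⟨k, rfl, hk⟩⟩
    · exact ⟨none, fun h' => absurd h' h⟩
  choose area harea using hex
  have hmaps : ∀ i ∈ I.filter (· ∈ faulty pos F g),
      area i ∈ (Finset.univ : Finset (Fin M)).map Function.Embedding.some := by
    intro i hi
    obtain ⟨k, hk, -⟩ := harea i (Finset.mem_filter.mp hi).2
    simp [hk]
  have hinj : Set.InjOn area (I.filter (· ∈ faulty pos F g) : Finset (Fin N)) := by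
    intro i hi j hj hij
    obtain ⟨hiI, hiB⟩ := Finset.mem_filter.mp (Finset.mem_coe.mp hi)
    obtain ⟨hjI, hjB⟩ := Finset.mem_filter.mp (Finset.mem_coe.mp hj)
    obtain ⟨k, hk, hik⟩ := harea i hiB
    obtain ⟨l, hl, hjl⟩ := harea j hjB
    have hkl : k = l := Option.some.inj (by rw [← hk, ← hl, hij])
    subst hkl
    by_contra hne
    exact absurd (hI i hiI j hjI hne) (not_lt.mpr (dist_le_of_mem_area hF (g k) hik hjl))
  simpa using Finset.card_le_card_of_injOn area hmaps hinj

/-! ### Independent sets in a half-disc -/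

/-- Two points of a disc about the origin seen from there under an angle of at most `π / 3` are
at most the radius apart. -/
theorem dist_le_of_arg_close {D : ℝ} {u v : ℂ} (hu : ‖u‖ ≤ D) (hv : ‖v‖ ≤ D)
    (h : |u.arg - v.arg| ≤ Real.pi / 3) : dist u v ≤ D := by
  have hD : 0 ≤ D := (norm_nonneg u).trans hu
  have hcos : 1 / 2 ≤ Real.cos (u.arg - v.arg) := by
    rw [← Real.cos_abs, ← Real.cos_pi_div_three]
    exact Real.cos_le_cos_of_nonneg_of_le_pi (abs_nonneg _) (by linarith [Real.pi_pos]) h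
  rw [Real.cos_sub] at hcos
  have hur := Complex.norm_mul_cos_arg u
  have hui := Complex.norm_mul_sin_arg u
  have hvr := Complex.norm_mul_cos_arg v
  have hvi := Complex.norm_mul_sin_arg v
  rw [Complex.dist_eq_re_im, ← hur, ← hui, ← hvr, ← hvi]
  apply Real.sqrt_le_iff.mpr ⟨hD, ?_⟩
  have h1 := Real.sin_sq_add_cos_sq u.arg
  have h2 := Real.sin_sq_add_cos_sq v.arg
  set r := ‖u‖
  set s := ‖v‖
  have hr : 0 ≤ r := norm_nonneg u
  have hs : 0 ≤ s := norm_nonneg v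
  set c := Real.cos u.arg * Real.cos v.arg + Real.sin u.arg * Real.sin v.arg
  have hexp : (r * Real.cos u.arg - s * Real.cos v.arg) ^ 2 +
      (r * Real.sin u.arg - s * Real.sin v.arg) ^ 2 = r ^ 2 + s ^ 2 - 2 * (r * s) * c := by
    linear_combination r ^ 2 * h1 + s ^ 2 * h2
  have hc : r * s * (1 / 2) ≤ r * s * c := mul_le_mul_of_nonneg_left hcos (mul_nonneg hr hs)
  rw [hexp]
  rcases le_total r s with hrs | hrs
  · nlinarith [mul_nonneg hr (sub_nonneg.mpr hrs)]
  · nlinarith [mul_nonneg hs (sub_nonneg.mpr hrs)]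

/-- The half-disc of radius `D` to the right of a point has no four points with pairwise distances
greater than `D`: it consists of three sectors of angle `π / 3`. -/
theorem card_le_three_of_half_disc {N : ℕ} {pos : Fin N → Plane} {D : ℝ} {i : Fin N}
    {I : Finset (Fin N)} (hdist : ∀ j ∈ I, dist (pos i) (pos j) ≤ D)
    (hright : ∀ j ∈ I, pos i 0 ≤ pos j 0) (hI : Independent pos D I) : I.card ≤ 3 := by
  by_contra! hcard
  let z : Fin N → ℂ := fun j => ⟨pos j 0 - pos i 0, pos j 1 - pos i 1⟩
  have hz : ∀ j k, dist (z j) (z k) = dist (pos j) (pos k) := by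
    intro j k
    rw [Complex.dist_eq_re_im, EuclideanSpace.dist_eq]
    simp [z, Fin.sum_univ_two, Real.dist_eq, sq_abs]
  have hnorm : ∀ j ∈ I, ‖z j‖ ≤ D := by
    intro j hj
    have h0 : z i = 0 := by apply Complex.ext <;> simp [z]
    rw [← dist_zero_left, ← h0, hz]
    exact hdist j hj
  have harg : ∀ j ∈ I, |(z j).arg| ≤ Real.pi / 2 := by
    intro j hj
    rw [Complex.abs_arg_le_pi_div_two_iff]
    exact sub_nonneg.mpr (hright j hj)
  let sector : Fin N → Fin 3 := fun j =>
    if (z j).arg ≤ -(Real.pi / 6) then 0 else if (z j).arg ≤ Real.pi / 6 then 1 else 2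
  obtain ⟨j, hj, k, hk, hjk, hs⟩ := Finset.exists_ne_map_eq_of_card_lt_of_maps_to
    (s := I) (t := (Finset.univ : Finset (Fin 3))) (f := sector) (by simpa using hcard)
    (fun _ _ => Finset.mem_coe.mpr (Finset.mem_univ _))
  have hclose : |(z j).arg - (z k).arg| ≤ Real.pi / 3 := by
    have h1 := abs_le.mp (harg j hj)
    have h2 := abs_le.mp (harg k hk)
    rw [abs_le]
    simp only [sector] at hs
    split_ifs at hs <;> first | exact absurd hs (by decide) | constructor <;> linarith
  have := dist_le_of_arg_close (hnorm j hj) (hnorm k hk) hclose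
  rw [hz] at this
  exact absurd (hI j hj k hk hjk) (not_lt.mpr this)

/-! ### Leader selection -/

theorem exists_lex_min {N : ℕ} {pos : Fin N → Plane} (hpos : Function.Injective pos)
    {C : Finset (Fin N)} (hC : C.Nonempty) :
    ∃ i ∈ C, ∀ j ∈ C, j ≠ i → LexLT (pos i) (pos j) := by
  obtain ⟨i, hi, hmin⟩ := C.exists_min_image (fun i => toLex (pos i 0, pos i 1)) hC
  refine ⟨i, hi, fun j hj hji => ?_⟩
  have hle := hmin j hj
  have hne : toLex (pos i 0, pos i 1) ≠ toLex (pos j 0, pos j 1) := by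
    intro h
    have h' := Prod.mk.inj (toLex.injective h)
    apply hji
    apply hpos
    ext k
    fin_cases k
    · exact h'.1.symm
    · exact h'.2.symm
  have hlt := lt_of_le_of_ne hle hne
  rw [Prod.Lex.toLex_lt_toLex] at hlt
  exact hlt

theorem exists_isNext {N : ℕ} {pos : Fin N → Plane} (hpos : Function.Injective pos) (D : ℝ)
    {C : Finset (Fin N)} (hC : C.Nonempty) : ∃ i, IsNext pos D C i := by
  -- The lexicographically smallest process of `C` has its neighbors in a half-disc.
  obtain ⟨i, hi, hmin⟩ := exists_lex_min hpos hC
  have hcand : (cand3 pos D C).Nonempty := by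
    refine ⟨i, Finset.mem_filter.mpr ⟨hi, fun I hIsub hI => ?_⟩⟩
    refine card_le_three_of_half_disc (i := i)
      (fun j hj => (Finset.mem_filter.mp (hIsub hj)).2) (fun j hj => ?_) hI
    by_cases hji : j = i
    · rw [hji]
    · rcases hmin j (Finset.mem_filter.mp (hIsub hj)).1 hji with h | h
      · exact h.le
      · exact h.1.le
  obtain ⟨k, hk, hkmin⟩ := exists_lex_min hpos hcand
  exact ⟨k, hk, hkmin⟩

/-- The selection never gets stuck, preserves independence, and each selected leader costs an
independent set of candidates at most three members. -/
theorem selectLoop_spec {N : ℕ} {pos : Fin N → Plane} (hpos : Function.Injective pos) {D : ℝ}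
    (hD : 0 ≤ D) (C L : Finset (Fin N)) (hL : Independent pos D L)
    (hCL : ∀ i ∈ C, ∀ j ∈ L, D < dist (pos i) (pos j)) :
    ∃ L', selectLoop pos D C L = some L' ∧ Independent pos D L' ∧
      ∀ S ⊆ C, Independent pos D S → S.card + 3 * L.card ≤ 3 * L'.card := by
  induction hn : C.card using Nat.strong_induction_on generalizing C L with
  | _ n ih =>
    by_cases hC : C = ∅
    · refine ⟨L, by rw [selectLoop, if_pos hC], hL, fun S hS _ => ?_⟩
      rw [hC, Finset.subset_empty] at hS
      simp [hS]
    · have hex := exists_isNext hpos D (Finset.nonempty_iff_ne_empty.mpr hC)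
      rw [selectLoop, if_neg hC, dif_pos hex]
      have hnext := hex.choose_spec
      set i := hex.choose
      obtain ⟨hiC, hthree⟩ := Finset.mem_filter.mp hnext.1
      have hmem : ∀ j, j ∈ C.erase i \ nb pos D C i ↔ j ∈ C ∧ D < dist (pos i) (pos j) := by
        intro j
        simp only [Finset.mem_sdiff, Finset.mem_erase, nb, Finset.mem_filter, not_and, not_le]
        constructor
        · rintro ⟨⟨-, hj⟩, h⟩
          exact ⟨hj, h hj⟩
        · rintro ⟨hj, h⟩
          refine ⟨⟨?_, hj⟩, fun _ => h⟩
          rintro rfl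
          rw [dist_self] at h
          exact absurd h (not_lt.mpr hD)
      have hiL : i ∉ L := by
        intro h
        have := hCL i hiC i h
        rw [dist_self] at this
        exact absurd this (not_lt.mpr hD)
      have hlt : (C.erase i \ nb pos D C i).card < n := by
        rw [← hn]
        exact lt_of_le_of_lt (Finset.card_le_card Finset.sdiff_subset)
          (Finset.card_erase_lt_of_mem hiC)
      obtain ⟨L', hL', hind, hcount⟩ := ih _ hlt (C.erase i \ nb pos D C i) (insert i L) (by
          intro a ha b hb hab
          rcases Finset.mem_insert.mp ha with rfl | ha
          · rcases Finset.mem_insert.mp hb with rfl | hb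
            · exact absurd rfl hab
            · exact hCL _ hiC b hb
          · rcases Finset.mem_insert.mp hb with rfl | hb
            · rw [dist_comm]
              exact hCL _ hiC a ha
            · exact hL a ha b hb hab) (by
          intro a ha b hb
          rcases Finset.mem_insert.mp hb with rfl | hb
          · rw [dist_comm]
            exact ((hmem a).mp ha).2
          · exact hCL a ((hmem a).mp ha).1 b hb) rfl
      refine ⟨L', hL', hind, fun S hSC hS => ?_⟩
      have hsub := hcount (S.filter (fun j => ¬ dist (pos i) (pos j) ≤ D))
        (fun j hj => (hmem j).mpr ⟨hSC (Finset.mem_filter.mp hj).1,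
          not_le.mp (Finset.mem_filter.mp hj).2⟩)
        (fun a ha b hb => hS a (Finset.mem_filter.mp ha).1 b (Finset.mem_filter.mp hb).1)
      have hnear := hthree (S.filter (fun j => dist (pos i) (pos j) ≤ D))
        (fun j hj => Finset.mem_filter.mpr ⟨hSC (Finset.mem_filter.mp hj).1,
          (Finset.mem_filter.mp hj).2⟩)
        (fun a ha b hb => hS a (Finset.mem_filter.mp ha).1 b (Finset.mem_filter.mp hb).1)
      have hsplit := Finset.card_filter_add_card_filter_not (s := S)
        (fun j => dist (pos i) (pos j) ≤ D)
      rw [Finset.card_insert_of_notMem hiL] at hsub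
      omega

theorem leaders_spec {N : ℕ} {pos : Fin N → Plane} (hpos : Function.Injective pos) {D : ℝ}
    (hD : 0 ≤ D) : ∃ L, leaders pos D = some L ∧ Independent pos D L ∧
      ∀ S, Independent pos D S → S.card ≤ 3 * L.card := by
  obtain ⟨L, hL, hind, hS⟩ := selectLoop_spec hpos hD Finset.univ ∅
    (fun i hi => absurd hi (Finset.notMem_empty i))
    (fun _ _ j hj => absurd hj (Finset.notMem_empty j))
  exact ⟨L, hL, hind, fun S h => by simpa using hS S (Finset.subset_univ S) h⟩

/-! ### Correctness of the algorithm of Pease, Shostak and Lamport -/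

/-- Correct processes report truthfully: what a correct `p` records as told by a correct `q` is
what `q` itself recorded, for strings of length at most `m + 2`. Here `S p` is the record of `p`
and `B` the set of Byzantine processes. -/
def FaithfulRelay {N : ℕ} (m : ℕ) (P : Finset (Fin N)) (B : Set (Fin N))
    (S : Fin N → List (Fin N) → Bool) : Prop :=
  ∀ p ∈ P, p ∉ B → ∀ q ∈ P, q ∉ B → ∀ w : List (Fin N), w.length ≤ m → (∀ a ∈ w, a ∈ P) →
    S p (p :: q :: w) = S q (q :: w)

section PSL

variable {N : ℕ} {B : Set (Fin N)}

theorem FaithfulRelay.erase {m : ℕ} {P : Finset (Fin N)} {S : Fin N → List (Fin N) → Bool}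
    (hS : FaithfulRelay (m + 1) P B S) {q : Fin N} (hq : q ∈ P) :
    FaithfulRelay m (P.erase q) B (fun p w => S p (w ++ [q])) := by
  intro p hp hpB r hr hrB w hw hwP
  refine hS p (Finset.mem_of_mem_erase hp) hpB r (Finset.mem_of_mem_erase hr) hrB (w ++ [q])
    (by simpa using hw) ?_
  intro a ha
  rcases List.mem_append.mp ha with ha | ha
  · exact Finset.mem_of_mem_erase (hwP a ha)
  · rwa [List.mem_singleton.mp ha]

/-- A value relayed along correct processes arrives unaltered. -/
theorem FaithfulRelay.chain {m : ℕ} {P : Finset (Fin N)} {S : Fin N → List (Fin N) → Bool}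
    (hS : FaithfulRelay m P B S) {q : Fin N} (hq : q ∈ P) (hqB : q ∉ B) :
    ∀ (w : List (Fin N)) (p : Fin N), p ∈ P → p ∉ B → w.length ≤ m →
      (∀ a ∈ w, a ∈ P ∧ a ∉ B) → S p (p :: (w ++ [q])) = S q [q] := by
  intro w
  induction w with
  | nil =>
    intro p hp hpB _ _
    exact hS p hp hpB q hq hqB [] (Nat.zero_le _) (by simp)
  | cons a w ih =>
    intro p hp hpB hlen hw
    have ha := hw a List.mem_cons_self
    have hlen' : w.length + 1 ≤ m := hlen
    have h := hS p hp hpB a ha.1 ha.2 (w ++ [q]) (by simpa using hlen') (by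
      intro b hb
      rcases List.mem_append.mp hb with hb | hb
      · exact (hw b (List.mem_cons_of_mem a hb)).1
      · rwa [List.mem_singleton.mp hb])
    exact h.trans (ih a ha.1 ha.2 (by omega) (fun b hb => hw b (List.mem_cons_of_mem a hb)))

theorem Confirmed.direct {m : ℕ} {P : Finset (Fin N)} {σ : List (Fin N) → Bool} {p q : Fin N}
    {v : Bool} (h : Confirmed m P σ p q v) : σ [p, q] = v := by
  obtain ⟨Q, -, -, hw⟩ := h
  exact hw [] (Nat.zero_le _) (by simp)

theorem pslRecord_self (m : ℕ) (P : Finset (Fin N)) (σ : List (Fin N) → Bool) (p : Fin N) :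
    pslRecord m P σ p p = some (σ [p]) := by
  cases m <;> simp [pslRecord]

theorem pslRecord_of_confirmed {m : ℕ} {P : Finset (Fin N)} {σ : List (Fin N) → Bool}
    {p q : Fin N} {v : Bool} (hqp : q ≠ p) (h : Confirmed m P σ p q v) :
    pslRecord m P σ p q = some v := by
  cases v with
  | true => cases m <;> rw [pslRecord, if_neg hqp, if_pos h]
  | false =>
    have hnt : ¬ Confirmed m P σ p q true := fun ht => by
      have h1 := h.direct
      rw [ht.direct] at h1
      exact absurd h1 (by decide)
    cases m <;> rw [pslRecord, if_neg hqp, if_neg hnt, if_pos h]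

theorem two_card_inter {P Q R : Finset (Fin N)} {m : ℕ} (hQ : Q ⊆ P) (hR : R ⊆ P)
    (hQc : P.card + m < 2 * Q.card) (hRc : P.card + m < 2 * R.card) : m < (Q ∩ R).card := by
  have h1 := Finset.card_union_add_card_inter Q R
  have h2 := Finset.card_le_card (Finset.union_subset hQ hR)
  omega

theorem pslRecord_of_correct {m : ℕ} {P : Finset (Fin N)} {S : Fin N → List (Fin N) → Bool}
    (hn : 3 * m < P.card) (hB : (P.filter (· ∈ B)).card ≤ m) (hS : FaithfulRelay m P B S)
    {p q : Fin N} (hp : p ∈ P) (hpB : p ∉ B) (hq : q ∈ P) (hqB : q ∉ B) :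
    pslRecord m P (S p) p q = some (S q [q]) := by
  by_cases hqp : q = p
  · rw [hqp, pslRecord_self]
  · apply pslRecord_of_confirmed hqp
    have hsplit := Finset.card_filter_add_card_filter_not (s := P) (· ∈ B)
    refine ⟨P.filter (· ∉ B), Finset.filter_subset _ _, by omega, fun w hw hwQ => ?_⟩
    · exact hS.chain hq hqB w p hp hpB hw (fun a ha => Finset.mem_filter.mp (hwQ a ha))

theorem pslRecord_of_count {m : ℕ} {P : Finset (Fin N)} {σ : List (Fin N) → Bool} {p q : Fin N}
    {v : Bool} (hq : q ∈ P) (hqp : q ≠ p) (hnt : ¬ Confirmed (m + 1) P σ p q true)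
    (hnf : ¬ Confirmed (m + 1) P σ p q false)
    (hv : (P.card + (m + 1)) / 2 ≤ ((P.erase q).filter
      (fun a => pslRecord m (P.erase q) (fun w => σ (w ++ [q])) p a = some v)).card) :
    pslRecord (m + 1) P σ p q = some v := by
  rw [pslRecord, if_neg hqp, if_neg hnt, if_neg hnf]
  cases v with
  | true => exact if_pos hv
  | false =>
    -- Both values together occur at most `|P| - 1 < 2 * ⌊(|P| + m + 1) / 2⌋` times.
    have hdisj : Disjoint
        ((P.erase q).filter
          (fun a => pslRecord m (P.erase q) (fun w => σ (w ++ [q])) p a = some true))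
        ((P.erase q).filter
          (fun a => pslRecord m (P.erase q) (fun w => σ (w ++ [q])) p a = some false)) := by
      rw [Finset.disjoint_filter]
      intro a _ h1 h2
      rw [h1] at h2
      exact absurd h2 (by decide)
    have hle := Finset.card_le_card (Finset.union_subset (Finset.filter_subset
        (fun a => pslRecord m (P.erase q) (fun w => σ (w ++ [q])) p a = some true) (P.erase q))
      (Finset.filter_subset
        (fun a => pslRecord m (P.erase q) (fun w => σ (w ++ [q])) p a = some false) (P.erase q)))
    rw [Finset.card_union_of_disjoint hdisj, Finset.card_erase_of_mem hq] at hle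
    have hpos := Finset.card_pos.mpr ⟨q, hq⟩
    have hnot : ¬ (P.card + (m + 1)) / 2 ≤ ((P.erase q).filter
        (fun a => pslRecord m (P.erase q) (fun w => σ (w ++ [q])) p a = some true)).card := by
      omega
    exact (if_neg hnot).trans (if_pos hv)

/-- A value confirmed for `q` by a set `Q` is confirmed by `Q \ {q}` in the procedure for `m`, for
every member of `Q \ {q}`. -/
theorem pslRecord_erase_of_confirmed {m : ℕ} {P Q : Finset (Fin N)} {σ : List (Fin N) → Bool}
    {p q : Fin N} {v : Bool} (hq : q ∈ P) (hQP : Q ⊆ P) (hQ : P.card + (m + 1) < 2 * Q.card)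
    (hw : ∀ w : List (Fin N), w.length ≤ m + 1 → (∀ a ∈ w, a ∈ Q) → σ (p :: (w ++ [q])) = v)
    {a : Fin N} (ha : a ∈ Q.erase q) :
    pslRecord m (P.erase q) (fun w => σ (w ++ [q])) p a = some v := by
  by_cases hap : a = p
  · rw [hap, pslRecord_self]
    exact congrArg some (hw [] (Nat.zero_le _) (by simp))
  · apply pslRecord_of_confirmed hap
    refine ⟨Q.erase q, Finset.erase_subset_erase q hQP, ?_, fun w hlen hwQ => ?_⟩
    · rw [Finset.card_erase_of_mem hq]
      have := Finset.pred_card_le_card_erase (s := Q) (a := q)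
      have := Finset.card_pos.mpr ⟨q, hq⟩
      omega
    · refine hw (w ++ [a]) (by simpa using hlen) ?_
      intro b hb
      rcases List.mem_append.mp hb with hb | hb
      · exact Finset.mem_of_mem_erase (hwQ b hb)
      · rw [List.mem_singleton.mp hb]
        exact Finset.mem_of_mem_erase ha

/-- Interactive consistency: correct processes record the same values. -/
theorem pslRecord_agree (m : ℕ) (P : Finset (Fin N)) (S : Fin N → List (Fin N) → Bool)
    (hn : 3 * m < P.card) (hB : (P.filter (· ∈ B)).card ≤ m) (hS : FaithfulRelay m P B S)
    {p p' q : Fin N} (hp : p ∈ P) (hpB : p ∉ B) (hp' : p' ∈ P) (hp'B : p' ∉ B) (hq : q ∈ P) :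
    pslRecord m P (S p) p q = pslRecord m P (S p') p' q := by
  induction m generalizing P S p p' q with
  | zero =>
    have hqB : q ∉ B := by
      intro h
      have hqf : q ∈ P.filter (· ∈ B) := Finset.mem_filter.mpr ⟨hq, h⟩
      have := Finset.card_pos.mpr ⟨q, hqf⟩
      omega
    rw [pslRecord_of_correct hn hB hS hp hpB hq hqB,
      pslRecord_of_correct hn hB hS hp' hp'B hq hqB]
  | succ m ih =>
    by_cases hqB : q ∉ B
    · rw [pslRecord_of_correct hn hB hS hp hpB hq hqB,
        pslRecord_of_correct hn hB hS hp' hp'B hq hqB]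
    · rw [not_not] at hqB
      have hne : ∀ {r}, r ∉ B → q ≠ r := fun hr h => hr (h ▸ hqB)
      have hn' : 3 * m < (P.erase q).card := by
        rw [Finset.card_erase_of_mem hq]
        omega
      have hB' : ((P.erase q).filter (· ∈ B)).card ≤ m := by
        have hqf : q ∈ P.filter (· ∈ B) := Finset.mem_filter.mpr ⟨hq, hqB⟩
        rw [Finset.filter_erase, Finset.card_erase_of_mem hqf]
        omega
      have hvec : ∀ {r r'}, r ∈ P → r ∉ B → r' ∈ P → r' ∉ B → ∀ a ∈ P.erase q,
          pslRecord m (P.erase q) (fun w => S r (w ++ [q])) r a =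
            pslRecord m (P.erase q) (fun w => S r' (w ++ [q])) r' a :=
        fun hr hrB hr' hrB' a ha => ih (P.erase q) (fun p w => S p (w ++ [q])) hn' hB'
          (hS.erase hq) (Finset.mem_erase.mpr ⟨(hne hrB).symm, hr⟩) hrB
          (Finset.mem_erase.mpr ⟨(hne hrB').symm, hr'⟩) hrB' ha
      -- Two confirmed values agree: the confirming sets share a correct process.
      have hconf : ∀ {r r'} {v v' : Bool}, r ∈ P → r ∉ B → r' ∈ P → r' ∉ B →
          Confirmed (m + 1) P (S r) r q v → Confirmed (m + 1) P (S r') r' q v' → v = v' := by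
        rintro r r' v v' hr hrB hr' hrB' ⟨Q, hQP, hQc, hQ⟩ ⟨R, hRP, hRc, hR⟩
        have hcard := two_card_inter hQP hRP hQc hRc
        obtain ⟨a, ha, haB⟩ : ∃ a ∈ Q ∩ R, a ∉ B := by
          by_contra! hall
          have := Finset.card_le_card (s := Q ∩ R) (t := P.filter (· ∈ B)) (fun a ha =>
            Finset.mem_filter.mpr ⟨hQP (Finset.mem_of_mem_inter_left ha), hall a ha⟩)
          omega
        obtain ⟨haQ, haR⟩ := Finset.mem_inter.mp ha
        have h1 := hQ [a] (by simp) (by simpa using haQ)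
        have h2 := hR [a] (by simp) (by simpa using haR)
        have h3 := hS r hr hrB a (hQP haQ) haB [q] (by simp) (by simpa using hq)
        have h4 := hS r' hr' hrB' a (hQP haQ) haB [q] (by simp) (by simpa using hq)
        exact h1.symm.trans (h3.trans (h4.symm.trans h2))
      -- If `r` confirms `v`, then `r'` confirms `v` or counts `v` often enough.
      have hone : ∀ {r r'} {v : Bool}, r ∈ P → r ∉ B → r' ∈ P → r' ∉ B →
          Confirmed (m + 1) P (S r) r q v → pslRecord (m + 1) P (S r') r' q = some v := by
        intro r r' v hr hrB hr' hrB' hc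
        by_cases hex : ∃ v', Confirmed (m + 1) P (S r') r' q v'
        · obtain ⟨v', hv'⟩ := hex
          rw [pslRecord_of_confirmed (hne hrB') hv', hconf hr hrB hr' hrB' hc hv']
        · have hnone : ∀ u, ¬ Confirmed (m + 1) P (S r') r' q u := fun u hu => hex ⟨u, hu⟩
          obtain ⟨Q, hQP, hQc, hQ⟩ := hc
          apply pslRecord_of_count hq (hne hrB') (hnone true) (hnone false)
          have hsub : Q.erase q ⊆ (P.erase q).filter (fun a =>
              pslRecord m (P.erase q) (fun w => S r' (w ++ [q])) r' a = some v) := by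
            intro a ha
            have haP := Finset.erase_subset_erase q hQP ha
            refine Finset.mem_filter.mpr ⟨haP, ?_⟩
            rw [hvec hr' hrB' hr hrB a haP]
            exact pslRecord_erase_of_confirmed hq hQP hQc hQ ha
          have h1 := Finset.card_le_card hsub
          have h2 := Finset.pred_card_le_card_erase (s := Q) (a := q)
          omega
      by_cases hex : ∃ v, Confirmed (m + 1) P (S p) p q v
      · obtain ⟨v, hv⟩ := hex
        rw [hone hp hpB hp' hp'B hv, pslRecord_of_confirmed (hne hpB) hv]
      · by_cases hex' : ∃ v, Confirmed (m + 1) P (S p') p' q v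
        · obtain ⟨v, hv⟩ := hex'
          rw [hone hp' hp'B hp hpB hv, pslRecord_of_confirmed (hne hp'B) hv]
        · have h1 : ∀ u, ¬ Confirmed (m + 1) P (S p) p q u := fun u hu => hex ⟨u, hu⟩
          have h2 : ∀ u, ¬ Confirmed (m + 1) P (S p') p' q u := fun u hu => hex' ⟨u, hu⟩
          rw [pslRecord, if_neg (hne hpB), if_neg (h1 true), if_neg (h1 false),
            pslRecord, if_neg (hne hp'B), if_neg (h2 true), if_neg (h2 false)]
          have hfil : ∀ v, (P.erase q).filter (fun a =>
                pslRecord m (P.erase q) (fun w => S p (w ++ [q])) p a = some v) =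
              (P.erase q).filter (fun a =>
                pslRecord m (P.erase q) (fun w => S p' (w ++ [q])) p' a = some v) :=
            fun v => Finset.filter_congr (fun a ha => by rw [hvec hp hpB hp' hp'B a ha])
          simp only [hfil]

theorem pslDecision_agree {m : ℕ} {P : Finset (Fin N)} {S : Fin N → List (Fin N) → Bool}
    (hn : 3 * m < P.card) (hB : (P.filter (· ∈ B)).card ≤ m) (hS : FaithfulRelay m P B S)
    {p p' : Fin N} (hp : p ∈ P) (hpB : p ∉ B) (hp' : p' ∈ P) (hp'B : p' ∉ B) :
    pslDecision m P (S p) p = pslDecision m P (S p') p' := by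
  have hfil : ∀ v, P.filter (fun q => pslRecord m P (S p) p q = some v) =
      P.filter (fun q => pslRecord m P (S p') p' q = some v) :=
    fun v => Finset.filter_congr (fun q hq => by
      rw [pslRecord_agree m P S hn hB hS hp hpB hp' hp'B hq])
  simp only [pslDecision, hfil]

theorem pslDecision_valid {m : ℕ} {P : Finset (Fin N)} {S : Fin N → List (Fin N) → Bool}
    (hn : 3 * m < P.card) (hB : (P.filter (· ∈ B)).card ≤ m) (hS : FaithfulRelay m P B S)
    {p : Fin N} (hp : p ∈ P) (hpB : p ∉ B) {v : Bool}
    (hv : ∀ q ∈ P, q ∉ B → S q [q] = v) : pslDecision m P (S p) p = v := by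
  have hrec : ∀ q ∈ P, q ∉ B → pslRecord m P (S p) p q = some v := fun q hq hqB => by
    rw [pslRecord_of_correct hn hB hS hp hpB hq hqB, hv q hq hqB]
  have hsplit := Finset.card_filter_add_card_filter_not (s := P) (· ∈ B)
  have hgood : (P.filter (· ∉ B)).card ≤
      (P.filter (fun q => pslRecord m P (S p) p q = some v)).card :=
    Finset.card_le_card fun q hq => by
      obtain ⟨hq, hqB⟩ := Finset.mem_filter.mp hq
      exact Finset.mem_filter.mpr ⟨hq, hrec q hq hqB⟩
  have hbad : (P.filter (fun q => pslRecord m P (S p) p q = some (!v))).card ≤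
      (P.filter (· ∈ B)).card :=
    Finset.card_le_card fun q hq => by
      obtain ⟨hq, hqv⟩ := Finset.mem_filter.mp hq
      refine Finset.mem_filter.mpr ⟨hq, ?_⟩
      by_contra hqB
      rw [hrec q hq hqB] at hqv
      cases v <;> exact absurd hqv (by decide)
  cases v with
  | true =>
    simp only [Bool.not_true] at hbad
    exact decide_eq_true (by omega)
  | false =>
    simp only [Bool.not_false] at hbad
    exact decide_eq_false (by omega)

end PSL

/-! ### Computations of BASIC -/

section Run

variable {N M : ℕ} {pos : Fin N → Plane} {D : ℝ} {L : Finset (Fin N)} {B : Set (Fin N)}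
  {x : Fin N → Bool} {state : ℕ → Fin N → LocalState N} {msg : ℕ → Fin N → Fin N → Option (Msg N)}

/-- A computation of `basic` once the leaders are known. -/
structure IsRun (M : ℕ) (L : Finset (Fin N)) (B : Set (Fin N)) (x : Fin N → Bool)
    (state : ℕ → Fin N → LocalState N) (msg : ℕ → Fin N → Fin N → Option (Msg N)) : Prop where
  start : ∀ i, i ∉ B →
    state 0 i = { record := fun w => if w = [i] then x i else false, heard := ∅, out := none }
  sends : ∀ i, i ∉ B → ∀ r j, msg r i j = basicSend M L r i (state r i) j
  step : ∀ i, i ∉ B → ∀ r, state (r + 1) i = basicRecv M L r i (state r i) (fun k => msg r k i)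

theorem IsRun.of_isComputation (hL : leaders pos D = some L)
    (h : IsComputation (basic pos M D) B x state msg) : IsRun M L B x state msg where
  start := h.start
  sends i hi r j := by
    rw [h.sends i hi r j]
    simp only [basic, hL]
  step i hi r := by
    rw [h.step i hi r]
    simp only [basic, hL]

theorem IsRun.record_succ (h : IsRun M L B x state msg) {p : Fin N} (hp : p ∈ L) (hpB : p ∉ B)
    {r : ℕ} (hr : r ≤ M) :
    (state (r + 1) p).record = pslUpdate r p (state r p).record (fun k => msg r k p) := by
  rw [h.step p hpB r, basicRecv, if_pos hp, if_pos hr]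

/-- Round `r` of the exchange affects only strings of length `r + 2`. -/
theorem IsRun.record_stable (h : IsRun M L B x state msg) {p : Fin N} (hp : p ∈ L) (hpB : p ∉ B)
    {r s : ℕ} (hrs : r ≤ s) (hs : s ≤ M + 1) {w : List (Fin N)} (hw : w.length ≤ r + 1) :
    (state s p).record w = (state r p).record w := by
  induction s, hrs using Nat.le_induction with
  | base => rfl
  | succ s hrs ih =>
    rw [h.record_succ hp hpB (by omega), ← ih (by omega)]
    match w, hw with
    | [], _ => rfl
    | [_], _ => rfl
    | a :: q :: w, hw =>
      simp only [List.length_cons] at hw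
      exact if_neg (fun hc => by omega)

theorem IsRun.faithful (h : IsRun M L B x state msg) :
    FaithfulRelay M L B (fun p => (state (M + 1) p).record) := by
  intro p hp hpB q hq hqB w hw hwL
  show (state (M + 1) p).record (p :: q :: w) = (state (M + 1) q).record (q :: w)
  rw [h.record_stable hp hpB (r := w.length + 1) (by omega) le_rfl (by simp),
    h.record_stable hq hqB (r := w.length) (by omega) le_rfl (by simp),
    h.record_succ hp hpB hw]
  have hmsg : msg w.length q p = some (pslReport L w.length q (state w.length q).record) := by
    rw [h.sends q hqB, basicSend, if_pos hq, if_pos hw, if_pos hp]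
  have hover : ∀ a ∈ q :: w, a ∈ L := by
    intro a ha
    rcases List.mem_cons.mp ha with rfl | ha
    · exact hq
    · exact hwL a ha
  simp only [pslUpdate, true_and, if_true, hmsg, pslReport, reportedValue]
  rw [if_pos ⟨rfl, rfl, hover⟩]
  rfl

theorem IsRun.record_self (h : IsRun M L B x state msg) {p : Fin N} (hp : p ∈ L) (hpB : p ∉ B) :
    (state (M + 1) p).record [p] = x p := by
  rw [h.record_stable hp hpB (Nat.zero_le _) le_rfl (by simp), h.start p hpB]
  simp

theorem IsRun.leader_out (h : IsRun M L B x state msg) {p : Fin N} (hp : p ∈ L) (hpB : p ∉ B)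
    (r : ℕ) : (state r p).out =
      if r ≤ M + 1 then none else some (pslDecision M L (state (M + 1) p).record p) := by
  induction r with
  | zero => rw [h.start p hpB, if_pos (Nat.zero_le _)]
  | succ r ih =>
    rw [h.step p hpB r, basicRecv, if_pos hp]
    rcases lt_trichotomy r (M + 1) with hr | rfl | hr
    · rw [if_pos (by omega), if_pos (by omega)]
      exact ih.trans (if_pos (by omega))
    · rw [if_neg (by omega), if_pos rfl, if_neg (by omega)]
    · rw [if_neg (by omega), if_neg (by omega), if_neg (by omega)]
      exact ih.trans (if_neg (by omega))

theorem IsRun.decision_of_correct (h : IsRun M L B x state msg) {l i : Fin N} (hl : l ∈ L)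
    (hlB : l ∉ B) {r : ℕ} {u : Bool} (hu : msg r l i = some (Msg.decision u)) :
    u = pslDecision M L (state (M + 1) l).record l := by
  rw [h.sends l hlB, basicSend, if_pos hl] at hu
  split_ifs at hu with h1 h2 h3
  · exact absurd (Option.some.inj hu) (by simp [pslReport])
  · subst h3
    exact (Msg.decision.inj (Option.some.inj hu)).symm

theorem IsRun.heard_succ (h : IsRun M L B x state msg) {i : Fin N} (hi : i ∉ L) (hiB : i ∉ B)
    (r : ℕ) :
    (state (r + 1) i).heard = (state r i).heard ∪ decisionsIn L (fun k => msg r k i) := by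
  rw [h.step i hiB r, basicRecv, if_neg hi]

theorem IsRun.out_succ (h : IsRun M L B x state msg) {i : Fin N} (hi : i ∉ L) (hiB : i ∉ B)
    (r : ℕ) : (state (r + 1) i).out =
      if (state r i).out ≠ none then (state r i).out
      else if Supported M (state (r + 1) i).heard true then some true
      else if Supported M (state (r + 1) i).heard false then some false
      else none := by
  rw [h.heard_succ hi hiB, h.step i hiB r, basicRecv, if_neg hi]

variable {v : Bool}

theorem IsRun.heard_correct (h : IsRun M L B x state msg)
    (hv : ∀ l ∈ L, l ∉ B → pslDecision M L (state (M + 1) l).record l = v)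
    {i : Fin N} (hi : i ∉ L) (hiB : i ∉ B) (r : ℕ) :
    ∀ a ∈ (state r i).heard, a.1 ∈ L ∧ (a.1 ∉ B → a.2 = v) := by
  induction r with
  | zero =>
    rw [h.start i hiB]
    exact fun a ha => absurd ha (Finset.notMem_empty a)
  | succ r ih =>
    intro a ha
    rw [h.heard_succ hi hiB] at ha
    rcases Finset.mem_union.mp ha with ha | ha
    · exact ih a ha
    · obtain ⟨-, haL, hmsg⟩ := Finset.mem_filter.mp ha
      exact ⟨haL, fun haB =>
        (h.decision_of_correct haL haB hmsg).trans (hv a.1 haL haB)⟩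

theorem IsRun.supported_eq (h : IsRun M L B x state msg) (hB : (L.filter (· ∈ B)).card ≤ M)
    (hv : ∀ l ∈ L, l ∉ B → pslDecision M L (state (M + 1) l).record l = v)
    {i : Fin N} (hi : i ∉ L) (hiB : i ∉ B) {r : ℕ} {u : Bool}
    (hu : Supported M (state r i).heard u) : u = v := by
  by_contra hne
  have hle : ((state r i).heard.filter (fun a => a.2 = u)).card ≤ (L.filter (· ∈ B)).card := by
    refine Finset.card_le_card_of_injOn Prod.fst ?_ ?_
    · intro a ha
      obtain ⟨ha, hau⟩ := Finset.mem_filter.mp (Finset.mem_coe.mp ha)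
      obtain ⟨haL, hcor⟩ := h.heard_correct hv hi hiB r a ha
      refine Finset.mem_coe.mpr (Finset.mem_filter.mpr ⟨haL, ?_⟩)
      by_contra haB
      exact hne (hau.symm.trans (hcor haB))
    · intro a ha b hb hab
      exact Prod.ext hab ((Finset.mem_filter.mp (Finset.mem_coe.mp ha)).2.trans
        (Finset.mem_filter.mp (Finset.mem_coe.mp hb)).2.symm)
  have hu' : 2 * M + 1 ≤ ((state r i).heard.filter (fun a => a.2 = u)).card := hu
  omega

theorem IsRun.supported_final (h : IsRun M L B x state msg) (hn : 3 * M < L.card)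
    (hB : (L.filter (· ∈ B)).card ≤ M)
    (hv : ∀ l ∈ L, l ∉ B → pslDecision M L (state (M + 1) l).record l = v)
    {i : Fin N} (hi : i ∉ L) (hiB : i ∉ B) : Supported M (state (M + 2) i).heard v := by
  have hle : (L.filter (· ∉ B)).card ≤
      ((state (M + 2) i).heard.filter (fun a => a.2 = v)).card := by
    refine Finset.card_le_card_of_injOn (fun l => (l, v)) ?_ ?_
    · intro l hl
      obtain ⟨hl, hlB⟩ := Finset.mem_filter.mp (Finset.mem_coe.mp hl)
      refine Finset.mem_coe.mpr (Finset.mem_filter.mpr ⟨?_, rfl⟩)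
      rw [h.heard_succ hi hiB (M + 1)]
      refine Finset.mem_union_right _ (Finset.mem_filter.mpr ⟨Finset.mem_univ _, hl, ?_⟩)
      show msg (M + 1) l i = some (Msg.decision v)
      rw [h.sends l hlB, basicSend, if_pos hl, if_neg (by omega), if_pos rfl, hv l hl hlB]
    · intro a _ b _ hab
      exact congrArg Prod.fst hab
  have hsplit := Finset.card_filter_add_card_filter_not (s := L) (· ∈ B)
  show 2 * M + 1 ≤ _
  omega

theorem IsRun.out_eq_none_or (h : IsRun M L B x state msg) (hB : (L.filter (· ∈ B)).card ≤ M)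
    (hv : ∀ l ∈ L, l ∉ B → pslDecision M L (state (M + 1) l).record l = v)
    {i : Fin N} (hiB : i ∉ B) (r : ℕ) : (state r i).out = none ∨ (state r i).out = some v := by
  by_cases hi : i ∈ L
  · rw [h.leader_out hi hiB, hv i hi hiB]
    split_ifs <;> simp
  · induction r with
    | zero => exact Or.inl (by rw [h.start i hiB])
    | succ r ih =>
      rw [h.out_succ hi hiB]
      split_ifs with h1 h2 h3
      · exact ih
      · exact Or.inr (congrArg some (h.supported_eq hB hv hi hiB h2))
      · exact Or.inr (congrArg some (h.supported_eq hB hv hi hiB h3))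
      · exact Or.inl rfl

/-- Every correct process has output the common decision `v` of the correct leaders after `M + 2`
rounds, and keeps it. -/
theorem IsRun.out_final (h : IsRun M L B x state msg) (hn : 3 * M < L.card)
    (hB : (L.filter (· ∈ B)).card ≤ M)
    (hv : ∀ l ∈ L, l ∉ B → pslDecision M L (state (M + 1) l).record l = v)
    {i : Fin N} (hiB : i ∉ B) : (state (M + 2) i).out = some v := by
  by_cases hi : i ∈ L
  · rw [h.leader_out hi hiB, if_neg (by omega), hv i hi hiB]
  · have hsup := h.supported_final hn hB hv hi hiB
    rcases h.out_eq_none_or hB hv hiB (M + 2) with hnone | hsome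
    · exfalso
      rw [h.out_succ hi hiB (M + 1)] at hnone
      split_ifs at hnone with h1 h2 h3
      · exact h1 hnone
      · cases v
        · exact h3 hsup
        · exact h2 hsup
    · exact hsome

theorem IsRun.out_persist (h : IsRun M L B x state msg) {i : Fin N} (hiB : i ∉ B) {r s : ℕ}
    (hrs : r ≤ s) {u : Bool} (hu : (state r i).out = some u) : (state s i).out = some u := by
  by_cases hi : i ∈ L
  · rw [h.leader_out hi hiB] at hu ⊢
    split_ifs at hu with h1
    rwa [if_neg (by omega)]
  · induction s, hrs using Nat.le_induction with
    | base => exact hu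
    | succ s _ ih => rw [h.out_succ hi hiB, if_pos (by simp [ih]), ih]

theorem IsRun.quiet (h : IsRun M L B x state msg) {i : Fin N} (hiB : i ∉ B) {r : ℕ}
    (hr : M + 2 ≤ r) (j : Fin N) : msg r i j = none := by
  rw [h.sends i hiB, basicSend]
  split_ifs <;> first | omega | rfl

theorem IsRun.exists_decision (h : IsRun M L B x state msg) (hn : 3 * M < L.card)
    (hB : (L.filter (· ∈ B)).card ≤ M) :
    ∃ v, (∀ l ∈ L, l ∉ B → pslDecision M L (state (M + 1) l).record l = v) ∧
      ∀ u, (∀ i, i ∉ B → x i = u) → u = v := by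
  obtain ⟨p, hp⟩ : (L.filter (· ∉ B)).Nonempty := by
    rw [← Finset.card_pos]
    have := Finset.card_filter_add_card_filter_not (s := L) (· ∈ B)
    omega
  obtain ⟨hp, hpB⟩ := Finset.mem_filter.mp hp
  refine ⟨pslDecision M L (state (M + 1) p).record p, fun l hl hlB =>
    pslDecision_agree hn hB h.faithful hl hlB hp hpB, fun u hu => ?_⟩
  exact (pslDecision_valid hn hB h.faithful hp hpB fun q hq hqB =>
    (h.record_self hq hqB).trans (hu q hqB)).symm

theorem IsRun.isConsensus (h : IsRun M L B x state msg) (hn : 3 * M < L.card)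
    (hB : (L.filter (· ∈ B)).card ≤ M) : IsConsensus B x (fun r i => (state r i).out) := by
  obtain ⟨v, hv, hvalid⟩ := h.exists_decision hn hB
  have honly : ∀ {i}, i ∉ B → ∀ {r u}, (state r i).out = some u → u = v := by
    intro i hiB r u hu
    rcases h.out_eq_none_or hB hv hiB r with h1 | h1
    · rw [h1] at hu
      exact absurd hu (by simp)
    · rw [h1] at hu
      exact (Option.some.inj hu).symm
  exact
    { irrevocable := fun i hi r s u hrs hu => h.out_persist hi hrs hu
      agreement := fun i j hi hj r s a b ha hb => (honly hi ha).trans (honly hj hb).symm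
      validity := fun u hu i hi => ⟨M + 2, by
        rw [hvalid u hu]
        exact h.out_final hn hB hv hi⟩
      termination := fun i hi => ⟨M + 2, v, h.out_final hn hB hv hi⟩ }

end Run

end Geoconsensus

theorem theorem2 (N M : ℕ) (hM : 1 ≤ M)
    (F : Set Geoconsensus.Plane) (hF : Geoconsensus.IsFaultArea F)
    (D : ℝ) (hD : D = Metric.diam F)
    (pos : Fin N → Geoconsensus.Plane) (hpos : Function.Injective pos)
    (hsep : ∃ S : Finset (Fin N), 9 * M + 3 ≤ S.card ∧
      ∀ i ∈ S, ∀ j ∈ S, i ≠ j → D < dist (pos i) (pos j)) :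
    (∀ g : Fin M → Geoconsensus.Plane ≃ᵢ Geoconsensus.Plane,
        (Geoconsensus.faulty pos F g).ncard + (2 * M + 1) ≤ N) ∧
      Geoconsensus.SolvesGeoconsensus (Geoconsensus.basic pos M D) pos F M ∧
      Geoconsensus.FinishesWithin (Geoconsensus.basic pos M D) pos F M (M + 2) := by
  classical
  subst hD
  obtain ⟨S, hScard, hS⟩ := hsep
  obtain ⟨L, hL, hLind, hLcard⟩ := Geoconsensus.leaders_spec hpos (Metric.diam_nonneg (s := F))
  have hn : 3 * M < L.card := by
    have := hLcard S hS
    omega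
  have hB : ∀ g, (L.filter (· ∈ Geoconsensus.faulty pos F g)).card ≤ M := fun g => by
    convert Geoconsensus.card_faulty_le hF.2 g hLind
  refine ⟨fun g => ?_, fun g x state msg hc => ?_, fun g x state msg hc i hi => ?_⟩
  · have hf : (S.filter (· ∈ Geoconsensus.faulty pos F g)).card ≤ M := by
      convert Geoconsensus.card_faulty_le hF.2 g hS
    have hsplit := Finset.card_filter_add_card_filter_not (s := S)
      (· ∈ Geoconsensus.faulty pos F g)
    have hsub := Set.ncard_le_ncard (s := ((S.filter (· ∉ Geoconsensus.faulty pos F g) :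
      Finset (Fin N)) : Set (Fin N))) (t := (Geoconsensus.faulty pos F g)ᶜ)
      (fun i hi => (Finset.mem_filter.mp (Finset.mem_coe.mp hi)).2) (Set.toFinite _)
    rw [Set.ncard_coe_finset] at hsub
    have htot := Set.ncard_add_ncard_compl (Geoconsensus.faulty pos F g)
    rw [Nat.card_eq_fintype_card, Fintype.card_fin] at htot
    omega
  · have hrun := Geoconsensus.IsRun.of_isComputation hL hc
    exact hrun.isConsensus hn (by convert hB g)
  · have hrun := Geoconsensus.IsRun.of_isComputation hL hc
    obtain ⟨v, hv, -⟩ := hrun.exists_decision hn (by convert hB g)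
    exact ⟨⟨v, hrun.out_final hn (by convert hB g) hv hi⟩, fun r hr j => hrun.quiet hi hr j⟩
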